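/- Let $R$ be a finite ring, associative with identity, that is Frobenius: $R/\mathrm{Rad}(R)\cong\mathrm{Soc}(R_R)$ as right $R$-modules and $R/\mathrm{Rad}(R)\cong\mathrm{Soc}({}_RR)$ as left $R$-modules. Let $E=\{1,\dots,n\}$, let $C$ be a left $R$-linear code of length $n$ (a left $R$-submodule of $R^n$), and let $C^{\perp}=\{u\in R^n : \sum_{i} v_iu_i=0 \text{ for all } v\in C\}$ be its right dual code. Let $m,d\ge 0$ be integers and $f\in\mathrm{Harm}_d(n)$, that is, $f$ is a real-valued function on the $d$-element subsets of $E$ such that $\sum_{|Z|=d,\,Y\subseteq Z}f(Z)=0$ for every $Y\subseteq E$ with $|Y|=d-1$ (no condition if $d=0$). For $X\subseteq E$ put $\widetilde f(X)=\sum_{Z\subseteq X,\,|Z|=d}f(Z)$ and $\alpha_C(X)=\log_{|R|}|C\setminus(E-X)|$, where $C\setminus(E-X)\subseteq R^{|X|}$ is the punctured code obtained by deleting the coordinates in $E-X$ from every codeword of $C$. (For the zero ring, read $\alpha_C=0$.) For a left or right linear code $D$ of length $n$, the $m$-tuple harmonic weight enumerator of $D$ associated to $f$ is $$W^{[m]}_{D,f}(x,y)=\sum_{X\subseteq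 E}\widetilde f(X)\,A^{[m]}_D(X)\,x^{|E-X|}y^{|X|},$$ where $A^{[m]}_D(X)$ is the number of $m$-tuples $(u_1,\dots,u_m)\in D^m$ with $\mathrm{supp}(u_1)\cup\dots\cup\mathrm{supp}(u_m)=X$; and $Z^{[m]}_{D,f}(x,y)$ denotes the polynomial determined by $W^{[m]}_{D,f}(x,y)=(xy)^d\,Z^{[m]}_{D,f}(x,y)$. Then $W^{[m]}_{C^{\perp},f}$ is divisible by $(xy)^d$, so that $Z^{[m]}_{C^{\perp},f}$ is well defined, and $$Z^{[m]}_{C^{\perp},f}(x,y)=\sum_{\substack{X\subseteq E\\ d\le|X|\le n-d}}\widetilde f(X)\,(|R|^m)^{d-\alpha_C(X)}\,(x-y)^{|E-X|-d}\,(|R|^m y)^{|X|-d}.$$ -/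

import Mathlib

open MvPolynomial

namespace HarmonicCodes

/-! ### Finite Frobenius rings -/

/-- The socle of a module: the sum of all its simple submodules. -/
def socle (S M : Type*) [Ring S] [AddCommGroup M] [Module S M] : Submodule S M :=
  sSup {N : Submodule S M | IsSimpleModule S N}

/-- The Jacobson radical of `R`, a two-sided ideal, as a right `R`-submodule of `R`.
Right `R`-modules are modules over the opposite ring `Rᵐᵒᵖ`. -/
def radRight (R : Type*) [Ring R] : Submodule Rᵐᵒᵖ R where
  carrier := {a | a ∈ Ring.jacobson R}
  add_mem' := fun ha hb => (Ring.jacobson R).add_mem ha hb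
  zero_mem' := (Ring.jacobson R).zero_mem
  smul_mem' := fun c _ ha => Ideal.mul_mem_right c.unop (Ring.jacobson R) ha

/-- The Frobenius condition for a finite ring: `R / Rad(R)` is isomorphic to the socle of `R`,
both as right modules and as left modules. -/
structure IsFrobenius (R : Type*) [Ring R] : Prop where
  right_iso : Nonempty ((R ⧸ radRight R) ≃ₗ[Rᵐᵒᵖ] socle Rᵐᵒᵖ R)
  left_iso : Nonempty ((R ⧸ Ring.jacobson R) ≃ₗ[R] socle R R)

/-! ### Discrete harmonic functions on `E = Fin n` -/

/-- The set `E_d` of `d`-element subsets of `E = Fin n`. -/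
abbrev DSubset (n d : ℕ) : Type := {Z : Finset (Fin n) // Z.card = d}

/-- The extension `f̃ (X) = ∑ f(Z)`, summed over the `d`-subsets `Z` of `X`. -/
noncomputable def tilde {n d : ℕ} (f : DSubset n d → ℝ) (X : Finset (Fin n)) : ℝ :=
  ∑ Z : DSubset n d with Z.1 ⊆ X, f Z

/-- The differentiation `γ`, the linear map sending a basis element `Z ∈ E_d` to the formal sum of
the `(d-1)`-subsets of `Z`. There are none when `d = 0`, so `γ = 0` in that case. -/
noncomputable def gamma (n d : ℕ) : (DSubset n d → ℝ) →ₗ[ℝ] (Finset (Fin n) → ℝ) :=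
  Fintype.linearCombination ℝ
    (fun Z : DSubset n d => ∑ Y ∈ Z.1.powerset with Y.card + 1 = d, Pi.single Y (1 : ℝ))

/-- `Harm_d(n)`, the kernel of `γ` on `ℝ E_d`. -/
noncomputable def Harm (n d : ℕ) : Submodule ℝ (DSubset n d → ℝ) :=
  LinearMap.ker (gamma n d)

/-! ### Codes -/

/-- The right dual code of a left linear code, a right `R`-submodule of `R^n`. -/
def rightDual {R : Type*} [Ring R] {n : ℕ} (C : Submodule R (Fin n → R)) :
    Submodule Rᵐᵒᵖ (Fin n → R) where
  carrier := {u | ∀ v ∈ C, v ⬝ᵥ u = 0}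
  add_mem' := fun ha hb v hv => by rw [dotProduct_add, ha v hv, hb v hv, add_zero]
  zero_mem' := fun v _ => dotProduct_zero v
  smul_mem' := fun c u hu v hv => by rw [dotProduct_smul, hu v hv, smul_zero]

/-- The punctured code `C \ T`: the coordinates in `T` are deleted from every codeword. -/
def puncture {R : Type*} [Ring R] {n : ℕ} (C : Submodule R (Fin n → R)) (T : Finset (Fin n)) :
    Submodule R ({i : Fin n // i ∉ T} → R) :=
  C.map (LinearMap.funLeft R R Subtype.val)

/-- `α_C(X) = log_{|R|} |C \ (E - X)|`. -/
noncomputable def alpha {R : Type*} [Ring R] {n : ℕ} (C : Submodule R (Fin n → R))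
    (X : Finset (Fin n)) : ℝ :=
  Real.logb (Nat.card R) (Nat.card (puncture C Xᶜ))

/-- The number `A_C^{[m]}(X)` of `m`-tuples of codewords whose supports have union `X`.
It depends only on the set of codewords, so it serves left and right codes alike. -/
noncomputable def countTuples {R : Type*} [Ring R] {n : ℕ} (m : ℕ) (C : Set (Fin n → R))
    (X : Finset (Fin n)) : ℕ :=
  Nat.card {u : Fin m → Fin n → R //
    (∀ j, u j ∈ C) ∧ (⋃ j, Function.support (u j)) = (X : Set (Fin n))}

/-- The `m`-tuple harmonic weight enumerator `W_{C,f}^{[m]}(x, y)`, with `x = X 0`, `y = X 1`. -/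
noncomputable def W {R : Type*} [Ring R] {n d : ℕ} (m : ℕ) (C : Set (Fin n → R))
    (f : DSubset n d → ℝ) : MvPolynomial (Fin 2) ℝ :=
  ∑ S : Finset (Fin n),
    MvPolynomial.C (tilde f S * (countTuples m C S : ℝ)) * X 0 ^ Sᶜ.card * X 1 ^ S.card

/-- `Z_{C,f}^{[m]}(x, y)`, the quotient of `W_{C,f}^{[m]}(x, y)` by the monomial `(x y) ^ d`. When
the monomial divides `W`, as it does for harmonic `f`, this is the unique polynomial `Z` with
`W = (x y) ^ d * Z`. -/
noncomputable def Z {R : Type*} [Ring R] {n d : ℕ} (m : ℕ) (C : Set (Fin n → R))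
    (f : DSubset n d → ℝ) : MvPolynomial (Fin 2) ℝ :=
  MvPolynomial.divMonomial (W m C f) (Finsupp.single 0 d + Finsupp.single 1 d)

end HarmonicCodes

/-!
Duality over a Frobenius ring is a count of functionals. For a simple module `S` and a semisimple
module `A`, `|Hom(S, A)| = |Hom(A, S)|`; with `A = R / Rad(R) ≅ Soc(R)` this gives
`|Hom(S, R)| = |S|`. By dévissage `|Hom(M, R)| ≤ |M|` for every finite `M`, and since `R^k` has
exactly `|R^k|` functionals, the annihilator of a submodule `P` of `R^k` has `|R^k| / |P|` elements.
Applied to a punctured code, this counts the codewords of the dual code supported in a set `S`.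

Pairing `γ f = 0` with the indicator of the subsets of `S` yields
`∑_{i ∉ S} f̃(S ∪ {i}) = (|E - S| - d) f̃(S)`. Iterating, the sum of `f̃` over the supersets of `T`
with `k` further elements is `binom(|E - T| - d, k) f̃(T)`, and hence
`∑_{S ⊇ T} f̃(S) (x - y)^(|E - S| - d) y^|S - T| = f̃(T) x^(|E - T| - d)`. Substituting this in `W`
and exchanging the sums turns the numbers of `m`-tuples with a given union of supports into `m`-th
powers of numbers of codewords supported in a given set.
-/

namespace HarmonicCodes

/-! ### Functionals on modules over a Frobenius ring -/

section Homs

variable {R : Type*} [Ring R] {M : Type*} [AddCommGroup M] [Module R M]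

/-- The universal property of the quotient module `M ⧸ N`, as a bijection. -/
def liftQEquiv (N : Submodule R M) (Q : Type*) [AddCommGroup Q] [Module R Q] :
    {g : M →ₗ[R] Q // N ≤ LinearMap.ker g} ≃ (M ⧸ N →ₗ[R] Q) where
  toFun g := N.liftQ g.1 g.2
  invFun h := ⟨h ∘ₗ N.mkQ, fun x hx => by simp [(Submodule.Quotient.mk_eq_zero N).2 hx]⟩
  left_inv g := Subtype.ext (N.liftQ_mkQ g.1 g.2)
  right_inv h := Submodule.linearMap_qext N (N.liftQ_mkQ _ _)

theorem natCard_hom_le_mul [Finite M] (N : Submodule R M) (Q : Type*) [AddCommGroup Q]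
    [Module R Q] [Finite Q] :
    Nat.card (M →ₗ[R] Q) ≤ Nat.card (M ⧸ N →ₗ[R] Q) * Nat.card (N →ₗ[R] Q) := by
  have : Finite (N →ₗ[R] Q) := DFunLike.finite _
  let restrict := (LinearMap.lcomp ℕ Q N.subtype).toAddMonoidHom
  have mem_ker (g : M →ₗ[R] Q) : N ≤ LinearMap.ker g ↔ g ∈ restrict.ker :=
    ⟨fun h => LinearMap.ext fun x => h x.2, fun h x hx => LinearMap.congr_fun h ⟨x, hx⟩⟩
  have card_ker : Nat.card restrict.ker = Nat.card (M ⧸ N →ₗ[R] Q) :=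
    Nat.card_congr ((Equiv.subtypeEquivRight mem_ker).symm.trans (liftQEquiv N Q))
  rw [← restrict.ker.card_mul_index, AddSubgroup.index_ker, card_ker]
  exact Nat.mul_le_mul_left _ (Nat.card_le_card_of_injective _ Subtype.val_injective)

theorem natCard_hom_le_of_forall_isSimpleModule.{v} {Q : Type*} [AddCommGroup Q] [Module R Q]
    [Finite Q]
    (hQ : ∀ (S : Type v) [AddCommGroup S] [Module R S] [IsSimpleModule R S] [Finite S],
      Nat.card (S →ₗ[R] Q) ≤ Nat.card S)
    (M : Type v) [AddCommGroup M] [Module R M] [Finite M] :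
    Nat.card (M →ₗ[R] Q) ≤ Nat.card M := by
  have hM : IsFiniteLength R M :=
    isFiniteLength_iff_isNoetherian_isArtinian.2 ⟨inferInstance, inferInstance⟩
  revert ‹Finite M›
  induction hM with
  | of_subsingleton =>
    intro _
    simp
  | @of_simple_quotient M _ _ N _ _ ih =>
    intro _
    have : Finite (M ⧸ N) := Quotient.finite _
    calc Nat.card (M →ₗ[R] Q) ≤ Nat.card (M ⧸ N →ₗ[R] Q) * Nat.card (N →ₗ[R] Q) :=
          natCard_hom_le_mul N Q
      _ ≤ Nat.card (M ⧸ N) * Nat.card N := Nat.mul_le_mul (hQ _) ih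
      _ = Nat.card M := by rw [mul_comm, ← N.card_eq_card_quotient_mul_card]

end Homs

section SimpleModules

variable {R : Type*} [Ring R] (S : Type*) [AddCommGroup S] [Module R S] [IsSimpleModule R S]

theorem natCard_hom_comm_of_isSimpleModule (T : Type*) [AddCommGroup T] [Module R T]
    [IsSimpleModule R T] : Nat.card (S →ₗ[R] T) = Nat.card (T →ₗ[R] S) := by
  by_cases h : Nonempty (S ≃ₗ[R] T)
  · obtain ⟨e⟩ := h
    exact Nat.card_congr (e.arrowCongrAddEquiv e.symm).toEquiv
  · have eq_zero (g : S →ₗ[R] T) : g = 0 :=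
      g.bijective_or_eq_zero.resolve_left fun hg => h ⟨.ofBijective g hg⟩
    have eq_zero' (g : T →ₗ[R] S) : g = 0 :=
      g.bijective_or_eq_zero.resolve_left fun hg => h ⟨(LinearEquiv.ofBijective g hg).symm⟩
    have := subsingleton_of_forall_eq _ eq_zero
    have := subsingleton_of_forall_eq _ eq_zero'
    rw [Nat.card_of_subsingleton (0 : S →ₗ[R] T), Nat.card_of_subsingleton (0 : T →ₗ[R] S)]

theorem natCard_hom_comm_of_isSemisimpleModule (A : Type*) [AddCommGroup A] [Module R A]
    [IsSemisimpleModule R A] [Module.Finite R A] :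
    Nat.card (S →ₗ[R] A) = Nat.card (A →ₗ[R] S) := by
  obtain ⟨n, T, e, hT⟩ := IsSemisimpleModule.exists_linearEquiv_fin_dfinsupp R A
  let e' : A ≃ₗ[R] Π i, T i := e.trans DFinsupp.linearEquivFunOnFintype
  let homPi : (S →ₗ[R] Π i, T i) ≃ Π i, S →ₗ[R] T i :=
    { toFun g i := LinearMap.proj i ∘ₗ g
      invFun := LinearMap.pi
      left_inv _ := rfl
      right_inv _ := rfl }
  calc Nat.card (S →ₗ[R] A) = Nat.card (S →ₗ[R] Π i, T i) :=
        Nat.card_congr ((LinearEquiv.refl R S).arrowCongrAddEquiv e').toEquiv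
    _ = ∏ i, Nat.card (S →ₗ[R] T i) := by rw [Nat.card_congr homPi, Nat.card_pi]
    _ = ∏ i, Nat.card (T i →ₗ[R] S) :=
        Finset.prod_congr rfl fun i _ => natCard_hom_comm_of_isSimpleModule S (T i)
    _ = Nat.card ((Π i, T i) →ₗ[R] S) := by
        rw [← Nat.card_pi, Nat.card_congr (LinearMap.lsum R (fun i => T i) ℕ).toEquiv]
    _ = Nat.card (A →ₗ[R] S) :=
        Nat.card_congr (e'.symm.arrowCongrAddEquiv (LinearEquiv.refl R S)).toEquiv

theorem natCard_quotient_jacobson_hom : Nat.card (R ⧸ Ring.jacobson R →ₗ[R] S) = Nat.card S := by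
  rw [← Nat.card_congr (liftQEquiv (Ring.jacobson R) S),
    ← Nat.card_congr (LinearMap.ringLmapEquivSelf R ℕ S).toEquiv]
  exact Nat.card_congr (Equiv.subtypeUnivEquiv (IsSemisimpleModule.jacobson_le_ker R R R S))

theorem natCard_hom_quotient_jacobson [IsArtinianRing R] :
    Nat.card (S →ₗ[R] R ⧸ Ring.jacobson R) = Nat.card S := by
  have : IsSemisimpleModule R (R ⧸ Ring.jacobson R) :=
    (IsArtinian.isSemisimpleModule_iff_jacobson R _).2 (Module.jacobson_quotient_jacobson R R)
  rw [natCard_hom_comm_of_isSemisimpleModule, natCard_quotient_jacobson_hom]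

variable {S}

theorem range_le_socle {M : Type*} [AddCommGroup M] [Module R M] (g : S →ₗ[R] M) :
    LinearMap.range g ≤ socle R M := by
  rcases eq_or_ne g 0 with rfl | hg
  · simp
  · let e := LinearEquiv.ofInjective g (g.injective_of_ne_zero hg)
    exact le_sSup (IsSimpleModule.congr e.symm)

variable (S)

theorem natCard_hom_socle (M : Type*) [AddCommGroup M] [Module R M] :
    Nat.card (S →ₗ[R] socle R M) = Nat.card (S →ₗ[R] M) :=
  Nat.card_congr
    { toFun g := (socle R M).subtype ∘ₗ g
      invFun g := g.codRestrict (socle R M) fun s => range_le_socle g ⟨s, rfl⟩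
      left_inv _ := rfl
      right_inv _ := rfl }

end SimpleModules

section Frobenius

variable {R : Type*} [Ring R] [Finite R]

theorem IsFrobenius.natCard_hom_of_isSimpleModule (hR : IsFrobenius R) (S : Type*) [AddCommGroup S]
    [Module R S] [IsSimpleModule R S] : Nat.card (S →ₗ[R] R) = Nat.card S := by
  obtain ⟨e⟩ := hR.left_iso
  rw [← natCard_hom_socle, ← natCard_hom_quotient_jacobson (R := R) S]
  exact Nat.card_congr ((LinearEquiv.refl R S).arrowCongrAddEquiv e.symm).toEquiv

theorem IsFrobenius.natCard_hom_le (hR : IsFrobenius R) (M : Type*) [AddCommGroup M] [Module R M]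
    [Finite M] : Nat.card (M →ₗ[R] R) ≤ Nat.card M :=
  natCard_hom_le_of_forall_isSimpleModule
    (fun S _ _ _ _ => (hR.natCard_hom_of_isSimpleModule S).le) M

end Frobenius

section Annihilator

variable {R ι : Type*} [Ring R] [Fintype ι]

/-- The right annihilator of a left submodule `P` of `R^ι` with respect to the dot product, the
analogue of `rightDual` over an arbitrary finite index type. -/
def rightAnnihilator (P : Submodule R (ι → R)) : Set (ι → R) :=
  {w | ∀ v ∈ P, v ⬝ᵥ w = 0}

theorem natCard_rightAnnihilator (P : Submodule R (ι → R)) :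
    Nat.card (rightAnnihilator P) = Nat.card ((ι → R) ⧸ P →ₗ[R] R) := by
  let functional : (ι → R) ≃ ((ι → R) →ₗ[R] R) := (Pi.basisFun R ι).constr ℕ |>.toEquiv
  have functional_apply (w v : ι → R) : functional w v = v ⬝ᵥ w := by
    simp [functional, Module.Basis.constr_apply_fintype, dotProduct]
  refine Nat.card_congr ((functional.subtypeEquiv fun w => ?_).trans (liftQEquiv P R))
  simp only [rightAnnihilator, Set.mem_ofPred_eq, SetLike.le_def, LinearMap.mem_ker,
    functional_apply]

/-- `R^ι` has exactly as many functionals as vectors, so the upper bounds for the numbers of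
functionals on `P` and on `R^ι ⧸ P` must both be attained. -/
theorem IsFrobenius.natCard_rightAnnihilator_mul [Finite R] (hR : IsFrobenius R)
    (P : Submodule R (ι → R)) :
    Nat.card (rightAnnihilator P) * Nat.card P = Nat.card R ^ Fintype.card ι := by
  have : Finite ((ι → R) ⧸ P) := Quotient.finite _
  have card_fun : Nat.card (ι → R) = Nat.card R ^ Fintype.card ι := by
    rw [Nat.card_fun, Nat.card_eq_fintype_card (α := ι)]
  rw [natCard_rightAnnihilator, ← card_fun]
  apply le_antisymm
  · calc Nat.card ((ι → R) ⧸ P →ₗ[R] R) * Nat.card P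
        ≤ Nat.card ((ι → R) ⧸ P) * Nat.card P := Nat.mul_le_mul_right _ (hR.natCard_hom_le _)
      _ = Nat.card (ι → R) := by rw [mul_comm, ← P.card_eq_card_quotient_mul_card]
  · calc Nat.card (ι → R) = Nat.card ((ι → R) →ₗ[R] R) :=
          Nat.card_congr ((Pi.basisFun R ι).constr ℕ).toEquiv
      _ ≤ Nat.card ((ι → R) ⧸ P →ₗ[R] R) * Nat.card (P →ₗ[R] R) := natCard_hom_le_mul P R
      _ ≤ Nat.card ((ι → R) ⧸ P →ₗ[R] R) * Nat.card P := Nat.mul_le_mul_left _ (hR.natCard_hom_le _)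

end Annihilator

/-! ### Sums of harmonic functions over supersets -/

section Subsets

variable {α : Type*} [DecidableEq α]

theorem sum_powerset_card_add_one_eq {M : Type*} [AddCommMonoid M] (Z : Finset α)
    (g : Finset α → M) :
    ∑ Y ∈ Z.powerset with Y.card + 1 = Z.card, g Y = ∑ z ∈ Z, g (Z.erase z) := by
  have facets : {Y ∈ Z.powerset | Y.card + 1 = Z.card} = Z.image Z.erase := by
    ext Y
    have covBy_iff : Y ⊆ Z ∧ Y.card + 1 = Z.card ↔ Y ⋖ Z := by
      rw [Finset.covBy_iff_card_sdiff_eq_one]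
      refine and_congr_right fun hY => ?_
      have := Finset.card_le_card hY
      rw [Finset.card_sdiff_of_subset hY]
      lia
    simp [covBy_iff, Finset.covBy_iff_exists_erase]
  rw [facets, Finset.sum_image Z.erase_injOn]

variable [Fintype α]

theorem card_compl_add_card_sdiff {S T : Finset α} (h : T ⊆ S) :
    Sᶜ.card + (S \ T).card = Tᶜ.card := by
  have := Finset.card_le_card h
  have := Finset.card_le_univ S
  rw [Finset.card_compl, Finset.card_compl, Finset.card_sdiff_of_subset h]
  lia

theorem card_compl_erase_subset (Z S : Finset α) :
    {i ∈ Sᶜ | Z.erase i ⊆ S}.card + (if Z ⊆ S then Z.card else 0) =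
      (if Z ⊆ S then Sᶜ.card else 0) + {z ∈ Z | Z.erase z ⊆ S}.card := by
  split_ifs with hZ
  · have (i : α) : Z.erase i ⊆ S := (Z.erase_subset i).trans hZ
    simp [this]
  · have not_mem {i : α} (hi : Z.erase i ⊆ S) : i ∈ Z ↔ i ∉ S := by
      constructor
      · intro hiZ hiS
        rw [← Finset.subset_insert_iff, Finset.insert_eq_of_mem hiS] at hi
        exact hZ hi
      · exact fun _ => by_contra fun hiZ => hZ (Finset.erase_eq_of_notMem hiZ ▸ hi)
    rw [add_zero, zero_add]
    congr 1
    ext i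
    grind [Finset.mem_compl]

theorem sum_sum_compl_insert {M : Type*} [AddCommMonoid M] (T : Finset α) (k : ℕ)
    (h : Finset α → M) :
    ∑ S with T ⊆ S ∧ (S \ T).card = k, ∑ i ∈ Sᶜ, h (insert i S) =
      (k + 1) • ∑ S with T ⊆ S ∧ (S \ T).card = k + 1, h S := by
  calc ∑ S with T ⊆ S ∧ (S \ T).card = k, ∑ i ∈ Sᶜ, h (insert i S)
      = ∑ S with T ⊆ S ∧ (S \ T).card = k + 1, ∑ _ ∈ S \ T, h S := by
        rw [Finset.sum_sigma', Finset.sum_sigma']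
        refine Finset.sum_bij' (fun p _ => ⟨insert p.2 p.1, p.2⟩) (fun p _ => ⟨p.1.erase p.2, p.2⟩)
          (fun p _ => ?_) (fun p _ => ?_) (fun p hp => ?_) (fun p hp => ?_) (fun _ _ => rfl)
        · grind [Finset.mem_compl]
        · grind [Finset.mem_compl]
        · have : p.2 ∉ p.1 := by grind [Finset.mem_compl]
          simp [Finset.erase_insert this]
        · have : p.2 ∈ p.1 := by grind
          simp [Finset.insert_erase this]
    _ = (k + 1) • ∑ S with T ⊆ S ∧ (S \ T).card = k + 1, h S := by
        rw [Finset.smul_sum]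
        refine Finset.sum_congr rfl fun S hS => ?_
        rw [Finset.sum_const, (Finset.mem_filter.1 hS).2.2]

end Subsets

section Harmonic

variable {n d : ℕ}

theorem sum_gamma_mul (f : DSubset n d → ℝ) (g : Finset (Fin n) → ℝ) :
    ∑ Y, gamma n d f Y * g Y = ∑ Z, f Z * ∑ z ∈ Z.1, g (Z.1.erase z) := by
  simp only [gamma, Fintype.linearCombination_apply, Finset.sum_apply, Pi.smul_apply, smul_eq_mul,
    Finset.sum_mul]
  rw [Finset.sum_comm]
  refine Finset.sum_congr rfl fun Z _ => ?_
  simp only [← sum_powerset_card_add_one_eq, Z.2, mul_assoc, ← Finset.mul_sum, Finset.sum_mul]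
  rw [Finset.sum_comm]
  simp [Pi.single_apply]

theorem tilde_eq_sum_ite (f : DSubset n d → ℝ) (S : Finset (Fin n)) :
    tilde f S = ∑ Z, f Z * if Z.1 ⊆ S then 1 else 0 := by
  simp [tilde, Finset.sum_filter]

theorem tilde_eq_zero_of_card_lt (f : DSubset n d → ℝ) {S : Finset (Fin n)} (hS : S.card < d) :
    tilde f S = 0 :=
  Finset.sum_eq_zero fun Z hZ => by
    have := Finset.card_le_card (Finset.mem_filter.1 hZ).2
    have := Z.2
    lia

variable {f : DSubset n d → ℝ}

theorem sum_mul_sum_erase_eq_zero (hf : f ∈ Harm n d) (g : Finset (Fin n) → ℝ) :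
    ∑ Z, f Z * ∑ z ∈ Z.1, g (Z.1.erase z) = 0 := by
  rw [← sum_gamma_mul, LinearMap.mem_ker.1 hf]
  simp

theorem sum_tilde_insert (hf : f ∈ Harm n d) (S : Finset (Fin n)) :
    ∑ i ∈ Sᶜ, tilde f (insert i S) = (Sᶜ.card - d) * tilde f S := by
  have count (Z : DSubset n d) :
      (∑ i ∈ Sᶜ, if Z.1 ⊆ insert i S then 1 else 0) =
        (Sᶜ.card - d) * (if Z.1 ⊆ S then 1 else 0) +
          (∑ z ∈ Z.1, if Z.1.erase z ⊆ S then 1 else 0 : ℝ) := by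
    have := card_compl_erase_subset Z.1 S
    rw [Z.2] at this
    simp only [Finset.subset_insert_iff, Finset.sum_boole]
    split_ifs at this ⊢
    all_goals
      have := congrArg (Nat.cast (R := ℝ)) this
      push_cast at this
      linarith
  calc ∑ i ∈ Sᶜ, tilde f (insert i S)
      = ∑ Z, f Z * ∑ i ∈ Sᶜ, if Z.1 ⊆ insert i S then 1 else 0 := by
        simp only [tilde_eq_sum_ite, Finset.mul_sum]
        exact Finset.sum_comm
    _ = (Sᶜ.card - d) * tilde f S +
          ∑ Z, f Z * ∑ z ∈ Z.1, if Z.1.erase z ⊆ S then 1 else 0 := by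
        simp only [count, mul_add, Finset.sum_add_distrib, tilde_eq_sum_ite, Finset.mul_sum,
          mul_left_comm]
    _ = (Sᶜ.card - d) * tilde f S := by
        rw [sum_mul_sum_erase_eq_zero hf fun Y => if Y ⊆ S then 1 else 0, add_zero]

theorem tilde_eq_zero_of_card_compl_lt (hf : f ∈ Harm n d) {S : Finset (Fin n)}
    (hS : Sᶜ.card < d) : tilde f S = 0 := by
  induction h : Sᶜ.card using Nat.strong_induction_on generalizing S with
  | _ c ih =>
    have sum_eq_zero : ∑ i ∈ Sᶜ, tilde f (insert i S) = 0 :=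
      Finset.sum_eq_zero fun i hi => by
        have card_lt : (insert i S)ᶜ.card < Sᶜ.card := by
          rw [Finset.compl_insert]
          exact Finset.card_erase_lt_of_mem hi
        exact ih _ (h ▸ card_lt) (card_lt.trans hS) rfl
    rw [sum_tilde_insert hf] at sum_eq_zero
    have : (Sᶜ.card : ℝ) < d := by exact_mod_cast hS
    exact (mul_eq_zero.1 sum_eq_zero).resolve_left (by linarith)

theorem sum_tilde_superset (hf : f ∈ Harm n d) (T : Finset (Fin n)) (k : ℕ) :
    ∑ S with T ⊆ S ∧ (S \ T).card = k, tilde f S = (Tᶜ.card - d).choose k * tilde f T := by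
  induction k with
  | zero =>
    have (S : Finset (Fin n)) : T ⊆ S ∧ (S \ T).card = 0 ↔ T = S := by
      rw [Finset.card_eq_zero, Finset.sdiff_eq_empty_iff_subset, subset_antisymm_iff]
    simp only [this, Finset.sum_filter, Finset.sum_ite_eq, Finset.mem_univ, if_true,
      Nat.choose_zero_right, Nat.cast_one, one_mul]
  | succ k ih =>
    have level_succ : (k + 1) * ∑ S with T ⊆ S ∧ (S \ T).card = k + 1, tilde f S =
        (Tᶜ.card - k - d) * ((Tᶜ.card - d).choose k * tilde f T) := by
      rw [← Nat.cast_succ, ← nsmul_eq_mul, ← sum_sum_compl_insert, ← ih, Finset.mul_sum]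
      refine Finset.sum_congr rfl fun S hS => ?_
      obtain ⟨hTS, hk⟩ := (Finset.mem_filter.1 hS).2
      rw [sum_tilde_insert hf, ← card_compl_add_card_sdiff hTS, hk]
      push_cast
      ring
    rcases lt_or_ge Tᶜ.card d with hT | hT
    · rw [tilde_eq_zero_of_card_compl_lt hf hT] at level_succ ⊢
      have : (k + 1 : ℝ) ≠ 0 := by positivity
      simpa [this] using level_succ
    · have choose_succ : (Tᶜ.card - d).choose (k + 1) * (k + 1 : ℝ) =
          (Tᶜ.card - d).choose k * (Tᶜ.card - k - d) := by
        rw [← Nat.cast_succ, ← Nat.cast_mul, Nat.choose_succ_right_eq]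
        rcases le_or_gt k (Tᶜ.card - d) with hk | hk
        · rw [Nat.cast_mul, Nat.cast_sub hk, Nat.cast_sub hT]
          ring
        · simp [Nat.choose_eq_zero_of_lt hk]
      refine mul_left_cancel₀ (by positivity : (k + 1 : ℝ) ≠ 0) ?_
      linear_combination level_succ - tilde f T * choose_succ

theorem sum_tilde_superset_smul_pow {A : Type*} [CommSemiring A] [Algebra ℝ A]
    (hf : f ∈ Harm n d) (T : Finset (Fin n)) (x y : A) :
    ∑ S with T ⊆ S, tilde f S • (x ^ (Sᶜ.card - d) * y ^ (S \ T).card) =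
      tilde f T • (x + y) ^ (Tᶜ.card - d) := by
  set N := Tᶜ.card with hN
  calc ∑ S with T ⊆ S, tilde f S • (x ^ (Sᶜ.card - d) * y ^ (S \ T).card)
      = ∑ k ∈ Finset.range (N + 1), ∑ S with T ⊆ S ∧ (S \ T).card = k,
          tilde f S • (x ^ (Sᶜ.card - d) * y ^ (S \ T).card) := by
        have maps_to : ∀ S ∈ ({S | T ⊆ S} : Finset _), (S \ T).card ∈ Finset.range (N + 1) := by
          intro S hS
          have := card_compl_add_card_sdiff (Finset.mem_filter.1 hS).2
          rw [Finset.mem_range]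
          lia
        rw [← Finset.sum_fiberwise_of_maps_to maps_to]
        simp only [Finset.filter_filter]
    _ = ∑ k ∈ Finset.range (N + 1),
          ((N - d).choose k * tilde f T) • (x ^ (N - d - k) * y ^ k) := by
        refine Finset.sum_congr rfl fun k _ => ?_
        rw [← sum_tilde_superset hf, Finset.sum_smul]
        refine Finset.sum_congr rfl fun S hS => ?_
        obtain ⟨hTS, hk⟩ := (Finset.mem_filter.1 hS).2
        rw [hk, hN, ← card_compl_add_card_sdiff hTS, hk, Nat.sub_right_comm, Nat.add_sub_cancel]
    _ = ∑ k ∈ Finset.range (N - d + 1),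
          ((N - d).choose k * tilde f T) • (x ^ (N - d - k) * y ^ k) := by
        refine (Finset.sum_subset (Finset.range_mono (by lia)) fun k _ hk => ?_).symm
        rw [Nat.choose_eq_zero_of_lt (by simpa using hk)]
        simp
    _ = tilde f T • (x + y) ^ (N - d) := by
        rw [add_comm x y, add_pow, Finset.smul_sum]
        refine Finset.sum_congr rfl fun k _ => ?_
        simp only [mul_comm _ (tilde f T), mul_smul, Nat.cast_smul_eq_nsmul, nsmul_eq_mul]
        ring_nf

theorem tilde_smul_pow_card_compl {A : Type*} [CommRing A] [Algebra ℝ A] (hf : f ∈ Harm n d)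
    (T : Finset (Fin n)) (x y : A) :
    tilde f T • x ^ Tᶜ.card =
      x ^ d * ∑ S with T ⊆ S, tilde f S • ((x - y) ^ (Sᶜ.card - d) * y ^ (S \ T).card) := by
  rw [sum_tilde_superset_smul_pow hf, sub_add_cancel, mul_smul_comm, ← pow_add]
  rcases lt_or_ge Tᶜ.card d with hT | hT
  · simp [tilde_eq_zero_of_card_compl_lt hf hT]
  · rw [Nat.add_sub_cancel' hT]

end Harmonic

/-! ### Weight enumerators and duality -/

section Codes

variable {R : Type*} [Ring R] {n d : ℕ}

/-- The set of codewords of `D` supported in `S`: the shortened code at the coordinates outside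
`S`, without deleting these coordinates. -/
def shorten {A ι : Type*} [Zero A] (D : Set (ι → A)) (S : Finset ι) : Set (ι → A) :=
  {u ∈ D | Function.support u ⊆ S}

theorem sum_countTuples_powerset [Finite R] (m : ℕ) (D : Set (Fin n → R)) (S : Finset (Fin n)) :
    ∑ T ∈ S.powerset, countTuples m D T = Nat.card (shorten D S) ^ m := by
  classical
  have := Fintype.ofFinite R
  let unionSupport (u : Fin m → Fin n → R) : Finset (Fin n) :=
    (⋃ j, Function.support (u j)).toFinset
  have support_subset (u : Fin m → Fin n → R) (j : Fin m) :
      Function.support (u j) ⊆ unionSupport u := by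
    simpa [unionSupport] using Set.subset_iUnion (fun j => Function.support (u j)) j
  have maps_to : ∀ u ∈ ({u | ∀ j, u j ∈ shorten D S} : Finset (Fin m → Fin n → R)),
      unionSupport u ∈ S.powerset := by
    intro u hu
    rw [Finset.mem_powerset, ← Finset.coe_subset, Set.coe_toFinset, Set.iUnion_subset_iff]
    exact fun j => ((Finset.mem_filter.1 hu).2 j).2
  calc ∑ T ∈ S.powerset, countTuples m D T
      = ({u | ∀ j, u j ∈ shorten D S} : Finset (Fin m → Fin n → R)).card := by
        rw [Finset.card_eq_sum_card_fiberwise maps_to]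
        refine Finset.sum_congr rfl fun T hT => ?_
        rw [countTuples, Nat.card_eq_fintype_card, Fintype.card_subtype]
        congr 1
        ext u
        simp only [Finset.mem_filter, Finset.mem_univ, true_and, ← Finset.coe_inj, unionSupport,
          Set.coe_toFinset]
        refine and_congr_left fun hu => forall_congr' fun j => ⟨fun hj => ⟨hj, ?_⟩, fun hj => hj.1⟩
        exact (support_subset u j).trans (by simpa [unionSupport, hu] using hT)
    _ = Nat.card (shorten D S) ^ m := by
        rw [← Fintype.card_subtype, ← Nat.card_eq_fintype_card,
          Nat.card_congr (Equiv.subtypePiEquivPi (p := fun _ : Fin m => (· ∈ shorten D S))),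
          Nat.card_pi]
        simp

theorem W_eq_sum_shorten [Finite R] (m : ℕ) (D : Set (Fin n → R)) {f : DSubset n d → ℝ}
    (hf : f ∈ Harm n d) :
    W m D f = ∑ S, C (tilde f S * (Nat.card (shorten D S) : ℝ) ^ m) *
      X 0 ^ d * (X 0 - X 1) ^ (Sᶜ.card - d) * X 1 ^ S.card := by
  set x : MvPolynomial (Fin 2) ℝ := X 0
  set y : MvPolynomial (Fin 2) ℝ := X 1
  calc W m D f
      = ∑ T, countTuples m D T * y ^ T.card * (tilde f T • x ^ Tᶜ.card) := by
        refine Finset.sum_congr rfl fun T _ => ?_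
        rw [smul_eq_C_mul, C_mul, map_natCast]
        ring
    _ = ∑ T, ∑ S with T ⊆ S, countTuples m D T *
          (tilde f S • (x ^ d * (x - y) ^ (Sᶜ.card - d) * y ^ S.card)) := by
        refine Finset.sum_congr rfl fun T _ => ?_
        rw [tilde_smul_pow_card_compl hf T x y, Finset.mul_sum, Finset.mul_sum]
        refine Finset.sum_congr rfl fun S hS => ?_
        rw [← Finset.card_sdiff_add_card_eq_card (Finset.mem_filter.1 hS).2, pow_add]
        simp only [smul_eq_C_mul]
        ring
    _ = ∑ S, ∑ T ∈ S.powerset, countTuples m D T *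
          (tilde f S • (x ^ d * (x - y) ^ (Sᶜ.card - d) * y ^ S.card)) :=
        Finset.sum_comm' (by simp)
    _ = ∑ S, C (tilde f S * (Nat.card (shorten D S) : ℝ) ^ m) *
          x ^ d * (x - y) ^ (Sᶜ.card - d) * y ^ S.card := by
        refine Finset.sum_congr rfl fun S _ => ?_
        rw [← Finset.sum_mul, ← Nat.cast_sum, sum_countTuples_powerset, smul_eq_C_mul, C_mul,
          C_pow, map_natCast, Nat.cast_pow]
        ring

theorem W_eq_mul_sum [Finite R] (m : ℕ) (D : Set (Fin n → R)) {f : DSubset n d → ℝ}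
    (hf : f ∈ Harm n d) :
    W m D f = (X 0 * X 1) ^ d * ∑ S : Finset (Fin n) with d ≤ S.card ∧ S.card + d ≤ n,
      C (tilde f S * (Nat.card (shorten D S) : ℝ) ^ m) *
        (X 0 - X 1) ^ (Sᶜ.card - d) * X 1 ^ (S.card - d) := by
  have tilde_eq_zero (S : Finset (Fin n)) (hS : ¬(d ≤ S.card ∧ S.card + d ≤ n)) :
      tilde f S = 0 := by
    rcases lt_or_ge S.card d with h | h
    · exact tilde_eq_zero_of_card_lt f h
    · refine tilde_eq_zero_of_card_compl_lt hf ?_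
      have := S.card_add_card_compl
      rw [Fintype.card_fin] at this
      lia
  rw [W_eq_sum_shorten m D hf, Finset.mul_sum, Finset.sum_filter]
  refine Finset.sum_congr rfl fun S _ => ?_
  split_ifs with hS
  · have split_pow : (X 1 : MvPolynomial (Fin 2) ℝ) ^ S.card = X 1 ^ d * X 1 ^ (S.card - d) := by
      rw [← pow_add, Nat.add_sub_cancel' hS.1]
    rw [split_pow]
    ring
  · simp [tilde_eq_zero S hS]

theorem Z_eq_sum [Finite R] (m : ℕ) (D : Set (Fin n → R)) {f : DSubset n d → ℝ}
    (hf : f ∈ Harm n d) :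
    Z m D f = ∑ S : Finset (Fin n) with d ≤ S.card ∧ S.card + d ≤ n,
      C (tilde f S * (Nat.card (shorten D S) : ℝ) ^ m) *
        (X 0 - X 1) ^ (Sᶜ.card - d) * X 1 ^ (S.card - d) := by
  rw [Z, W_eq_mul_sum m D hf, mul_pow, X_pow_eq_monomial, X_pow_eq_monomial, monomial_mul, one_mul,
    divMonomial_monomial_mul]

theorem W_eq_mul_Z [Finite R] (m : ℕ) (D : Set (Fin n → R)) {f : DSubset n d → ℝ}
    (hf : f ∈ Harm n d) : W m D f = (X 0 * X 1) ^ d * Z m D f := by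
  rw [Z_eq_sum m D hf, W_eq_mul_sum m D hf]

theorem restrict_dotProduct_restrict {A ι : Type*} [NonUnitalNonAssocSemiring A] [Fintype ι]
    [DecidableEq ι] {S : Finset ι} (v : ι → A) {u : ι → A} (hu : Function.support u ⊆ S) :
    (fun i : {i // i ∉ Sᶜ} => v i) ⬝ᵥ (fun i => u i) = v ⬝ᵥ u := by
  rw [dotProduct, dotProduct, ← Finset.sum_subtype S (by simp) fun i => v i * u i]
  refine Finset.sum_subset (Finset.subset_univ S) fun i _ hi => ?_
  rw [Function.notMem_support.1 fun hiu => hi (hu hiu), mul_zero]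

/-- Restriction to the coordinates in `S` identifies the codewords of the dual supported in `S`
with the annihilator of the punctured code. -/
def shortenRightDualEquiv (C : Submodule R (Fin n → R)) (S : Finset (Fin n)) :
    shorten (rightDual C : Set (Fin n → R)) S ≃ rightAnnihilator (puncture C Sᶜ) where
  toFun u := ⟨fun i => u.1 i, by
    rintro _ ⟨v, hv, rfl⟩
    exact (restrict_dotProduct_restrict v u.2.2).trans (u.2.1 v hv)⟩
  invFun w := ⟨fun i => if h : i ∉ Sᶜ then w.1 ⟨i, h⟩ else 0, by
    have support_subset : (Function.support fun i => if h : i ∉ Sᶜ then w.1 ⟨i, h⟩ else 0) ⊆ S := by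
      intro i hi
      by_contra h
      simp_all
    refine ⟨fun v hv => ?_, support_subset⟩
    rw [← restrict_dotProduct_restrict v support_subset]
    exact (congrArg _ (funext fun i => dif_pos i.2)).trans (w.2 _ ⟨v, hv, rfl⟩)⟩
  left_inv u := by
    ext i
    have : i ∉ S → u.1 i = 0 := fun hi => Function.notMem_support.1 fun hiu => hi (u.2.2 hiu)
    by_cases hi : i ∈ S <;> simp [hi, this]
  right_inv w := by
    ext i
    exact dif_pos i.2

theorem IsFrobenius.natCard_shorten_rightDual_mul [Finite R] (hR : IsFrobenius R)
    (C : Submodule R (Fin n → R)) (S : Finset (Fin n)) :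
    Nat.card (shorten (rightDual C : Set (Fin n → R)) S) * Nat.card (puncture C Sᶜ) =
      Nat.card R ^ S.card := by
  rw [Nat.card_congr (shortenRightDualEquiv C S), hR.natCard_rightAnnihilator_mul]
  simp

theorem natCard_rpow_alpha [Finite R] (C : Submodule R (Fin n → R)) (S : Finset (Fin n)) :
    (Nat.card R : ℝ) ^ alpha C S = Nat.card (puncture C Sᶜ) := by
  rcases subsingleton_or_nontrivial R with _ | _
  · simp
  · have one_lt : (1 : ℝ) < Nat.card R := by exact_mod_cast Finite.one_lt_card
    exact Real.rpow_logb (by positivity) one_lt.ne' (by exact_mod_cast Nat.card_pos)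

theorem IsFrobenius.natCard_shorten_rightDual_pow [Finite R] (hR : IsFrobenius R)
    (C : Submodule R (Fin n → R)) {S : Finset (Fin n)} (hS : d ≤ S.card) (m : ℕ) :
    (Nat.card (shorten (rightDual C : Set (Fin n → R)) S) : ℝ) ^ m =
      ((Nat.card R : ℝ) ^ m) ^ ((d : ℝ) - alpha C S) * ((Nat.card R : ℝ) ^ m) ^ (S.card - d) := by
  have card_pos : (0 : ℝ) < Nat.card R := by exact_mod_cast Nat.card_pos
  have puncture_pos : (0 : ℝ) < Nat.card (puncture C Sᶜ) := by exact_mod_cast Nat.card_pos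
  have card_eq : (Nat.card (shorten (rightDual C : Set (Fin n → R)) S) : ℝ) =
      (Nat.card R : ℝ) ^ ((d : ℝ) - alpha C S) * (Nat.card R : ℝ) ^ (S.card - d) := by
    rw [Real.rpow_sub card_pos, natCard_rpow_alpha, Real.rpow_natCast, div_mul_eq_mul_div,
      ← pow_add, Nat.add_sub_cancel' hS, eq_div_iff puncture_pos.ne']
    exact_mod_cast hR.natCard_shorten_rightDual_mul C S
  rw [card_eq, mul_pow, Real.rpow_pow_comm card_pos.le, pow_right_comm]

end Codes

end HarmonicCodes

theorem theorem3p6 {R : Type*} [Ring R] [Finite R] (hR : HarmonicCodes.IsFrobenius R)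
    (n d m : ℕ) (C : Submodule R (Fin n → R))
    (f : HarmonicCodes.DSubset n d → ℝ) (hf : f ∈ HarmonicCodes.Harm n d) :
    HarmonicCodes.W m (HarmonicCodes.rightDual C : Set (Fin n → R)) f =
        (X 0 * X 1) ^ d * HarmonicCodes.Z m (HarmonicCodes.rightDual C : Set (Fin n → R)) f ∧
      HarmonicCodes.Z m (HarmonicCodes.rightDual C : Set (Fin n → R)) f =
        ∑ S : Finset (Fin n) with d ≤ S.card ∧ S.card + d ≤ n,
          MvPolynomial.C (HarmonicCodes.tilde f S *
              ((Nat.card R : ℝ) ^ m) ^ ((d : ℝ) - HarmonicCodes.alpha C S)) *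
            (X 0 - X 1) ^ (Sᶜ.card - d) *
            (MvPolynomial.C ((Nat.card R : ℝ) ^ m) * X 1) ^ (S.card - d) := by
  refine ⟨HarmonicCodes.W_eq_mul_Z m _ hf, ?_⟩
  rw [HarmonicCodes.Z_eq_sum m _ hf]
  refine Finset.sum_congr rfl fun S hS => ?_
  have d_le_card : d ≤ S.card := (Finset.mem_filter.1 hS).2.1
  rw [hR.natCard_shorten_rightDual_pow C d_le_card, mul_pow, ← map_pow, ← mul_assoc, C_mul]
  ring
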